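/- Let $\alpha>0$ and $x>0$ be real numbers and let $y(t)$ be a polynomial with real coefficients. Let $K^\alpha y(x)=\int_0^x \frac{y(t)}{(x-t)^{1-\alpha}}\,dt$ (this integral converges absolutely), let $\zeta$ be the (analytically continued) Riemann zeta function, and for a positive integer $n$ put $h=x/n$. Then, as $n\to\infty$, $$h^{\alpha}\sum_{k=1}^{n-1}\frac{y(x-kh)}{k^{1-\alpha}}+\frac{y(0)}{2x^{1-\alpha}}h=K^{\alpha}y(x)+\frac{(\alpha-1)x^{\alpha-2}y(0)-x^{\alpha-1}y'(0)}{12}h^2+\zeta(1-\alpha)\,y(x)\,h^{\alpha}-\zeta(-\alpha)\,y'(x)\,h^{1+\alpha}+\zeta(-1-\alpha)\frac{y''(x)}{2}h^{2+\alpha}-\zeta(-2-\alpha)\frac{y'''(x)}{6}h^{3+\alpha}+O(h^4),$$ where the constant in $O(h^4)$ may depend on $\alpha$, $x$ and $y$, but not on $n$. -/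

import Mathlib

open MeasureTheory Filter Asymptotics

noncomputable section

/-- The fractional integral `K^α y(x) = ∫_0^x y(t) / (x - t)^(1 - α) dt`. -/
def fracK (α : ℝ) (y : ℝ → ℝ) (x : ℝ) : ℝ :=
  ∫ t in (0 : ℝ)..x, y t / (x - t) ^ (1 - α)

/-- The Riemann zeta function at a real argument, as a real number. -/
def realZeta (s : ℝ) : ℝ := (riemannZeta (s : ℂ)).re

/-- The Riemann zeta function is real at real arguments, so no information is lost by
taking the real part. -/
theorem ofReal_realZeta (s : ℝ) : ((realZeta s : ℝ) : ℂ) = riemannZeta (s : ℂ) := by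
  have h := riemannZeta_conj (s : ℂ)
  rw [Complex.conj_ofReal] at h
  exact Complex.conj_eq_iff_re.mp h.symm

/-- The trapezoidal sum `h^α ∑_{k=1}^{n-1} y(x - k h) / k^(1-α) + y(0) h / (2 x^(1-α))`. -/
def trapSum (α : ℝ) (y : ℝ → ℝ) (x h : ℝ) (n : ℕ) : ℝ :=
  h ^ α * ∑ k ∈ Finset.Ico 1 n, y (x - k * h) / (k : ℝ) ^ (1 - α)
    + y 0 / (2 * x ^ (1 - α)) * h

end

/-!
By linearity it is enough to treat `y(t) = c (x - t) ^ j`, since these polynomials span `ℝ[t]`. For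
such a `y` the weighted trapezoidal sum is, up to the factor `c h ^ (s + 1)` with `s = α - 1 + j`,
the power sum `∑_{1 ≤ k < n} k ^ s` (`trapSum_sub_fracK_const_sub_pow`), and the fractional integral
and the `h ^ 2` term account exactly for the three leading Euler–Maclaurin terms
`n ^ (s + 1) / (s + 1) - n ^ s / 2 + s n ^ (s - 1) / 12`. What has to be shown is therefore
`powerSumDefect s n = ζ(-s) + O(n ^ (s - 3))` for real `s > -1`
(`norm_powerSumDefect_sub_riemannZeta_le`); since `n h = x`, the error becomes `O(h ^ 4)`. For
`j ≥ 4` the exponent `s` exceeds `3`, and the same bound holds without the zeta value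
(`norm_powerSumDefect_le`), in accordance with the absence of a zeta term.

The rate comes from the Euler–Maclaurin remainder on a unit interval, which is bounded by a multiple
of `|(k + 1) ^ (s - 3) - k ^ (s - 3)|` and so telescopes. The constant is identified by analytic
continuation (`powerSumConstant_eq_riemannZeta`): the limit of the defect is analytic on
`re s < 3` apart from `s = -1`, and for `re s < -1` it is visibly the Dirichlet series of `ζ(-s)`.
-/

/-! ### The Euler–Maclaurin remainder for power sums -/

/-- The error of the three-term Euler–Maclaurin approximation to the power sum
`∑_{1 ≤ k < n} k ^ s`, without the constant term. It is complex-valued and defined for complex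
exponents, so that its limit can be continued analytically in `s`. -/
noncomputable def powerSumDefect (s : ℂ) (n : ℕ) : ℂ :=
  ∑ k ∈ Finset.Ico 1 n, (k : ℂ) ^ s - (n : ℂ) ^ (s + 1) / (s + 1) + (n : ℂ) ^ s / 2
    - s * (n : ℂ) ^ (s - 1) / 12

/-- Euler–Maclaurin on one unit interval. The kernel is `B₄(t - k) - B₄(0)`, where `B₄` is the
fourth Bernoulli polynomial; it vanishes to second order at both ends, which is why only values and first derivatives of `t ^ s` appear on the left. -/
theorem powerSumDefect_succ_sub {s : ℂ} (hs : s ≠ -1) {k : ℕ} (hk : 1 ≤ k) :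
    powerSumDefect s (k + 1) - powerSumDefect s k =
      -(s * (s - 1) * (s - 2) * (s - 3) / 24) *
        ∫ t in (k : ℝ)..(k + 1 : ℝ),
          ((t - k : ℂ) ^ 2 * (1 - (t - k)) ^ 2) * (t : ℂ) ^ (s - 4) := by
  have hk' : (0 : ℝ) < k := by exact_mod_cast hk
  have hs1 : s + 1 ≠ 0 := fun h => hs (eq_neg_of_add_eq_zero_left h)
  have hpos : ∀ t ∈ Set.uIcc (k : ℝ) (k + 1), 0 < t := by
    intro t ht
    rw [Set.uIcc_of_le (by linarith)] at ht
    linarith [ht.1]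
  have hpow : ∀ (t : ℝ), 0 < t → ∀ r : ℂ,
      HasDerivAt (fun y : ℝ => (y : ℂ) ^ r) (r * (t : ℂ) ^ (r - 1)) t := by
    intro t ht r
    rcases eq_or_ne r 0 with rfl | hr
    · simpa using hasDerivAt_const t (1 : ℂ)
    · exact hasDerivAt_ofReal_cpow_const ht.ne' hr
  have hcont : IntervalIntegrable (fun t : ℝ => s * (s - 1) * (s - 2) * (s - 3) *
      (((t - k : ℂ) ^ 2 * (1 - (t - k)) ^ 2) * (t : ℂ) ^ (s - 4))) volume k (k + 1) := by
    apply ContinuousOn.intervalIntegrable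
    intro t ht
    have := (hpow t (hpos t ht) (s - 4)).continuousAt
    have h2 : ContinuousAt (fun t : ℝ => (t - k : ℂ) ^ 2 * (1 - (t - k)) ^ 2) t := by fun_prop
    exact ((h2.mul this).const_mul _).continuousWithinAt
  -- Four integrations by parts, recorded as a single antiderivative.
  have key := intervalIntegral.integral_eq_sub_of_hasDerivAt
    (f := fun t : ℝ =>
      ((t - k : ℂ) ^ 2 * (1 - (t - k)) ^ 2) * (s * (s - 1) * (s - 2) * (t : ℂ) ^ (s - 3))
      - (4 * (t - k : ℂ) ^ 3 - 6 * (t - k) ^ 2 + 2 * (t - k)) * (s * (s - 1) * (t : ℂ) ^ (s - 2))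
      + (12 * (t - k : ℂ) ^ 2 - 12 * (t - k) + 2) * (s * (t : ℂ) ^ (s - 1))
      - (24 * (t - k : ℂ) - 12) * (t : ℂ) ^ s + 24 / (s + 1) * (t : ℂ) ^ (s + 1))
    (a := k) (b := k + 1) (fun t ht => ?_) hcont
  · rw [intervalIntegral.integral_const_mul] at key
    have e : powerSumDefect s (k + 1) - powerSumDefect s k = -(1 / 24) *
        (s * (s - 1) * (s - 2) * (s - 3) * ∫ t in (k : ℝ)..(k + 1 : ℝ),
          ((t - k : ℂ) ^ 2 * (1 - (t - k)) ^ 2) * (t : ℂ) ^ (s - 4)) := by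
      rw [key]
      simp only [powerSumDefect, Finset.sum_Ico_succ_top hk]
      push_cast
      field_simp
      ring
    rw [e]
    ring
  · have ht := hpos t ht
    have hlin : HasDerivAt (fun t : ℝ => (t - k : ℂ)) 1 t :=
      (Complex.ofRealCLM.hasDerivAt (x := t)).sub_const _
    have h3 := (hpow t ht (s - 3)).const_mul (s * (s - 1) * (s - 2))
    have h2 := (hpow t ht (s - 2)).const_mul (s * (s - 1))
    have h1 := (hpow t ht (s - 1)).const_mul s
    have h0 := hpow t ht s
    have h01 := (hpow t ht (s + 1)).const_mul (24 / (s + 1))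
    have q0 := (hlin.pow 2).mul ((hlin.const_sub 1).pow 2)
    have q1 := (((hlin.pow 3).const_mul 4).sub ((hlin.pow 2).const_mul 6)).add (hlin.const_mul 2)
    have q2 := (((hlin.pow 2).const_mul 12).sub (hlin.const_mul 12)).add_const 2
    have q3 := (hlin.const_mul 24).sub_const 12
    have := ((((q0.mul h3).sub (q1.mul h2)).add (q2.mul h1)).sub (q3.mul h0)).add h01
    refine this.congr_deriv ?_
    simp only [show s - 3 - 1 = s - 4 by ring, show s - 2 - 1 = s - 3 by ring,
      show s - 1 - 1 = s - 2 by ring, show s + 1 - 1 = s by ring]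
    simp only [Pi.pow_apply, Pi.mul_apply, Pi.sub_apply, Pi.add_apply]
    field_simp
    push_cast
    ring

theorem norm_powerSumDefect_succ_sub_le {s : ℂ} (hs : s ≠ -1) {k : ℕ} (hk : 1 ≤ k) :
    ‖powerSumDefect s (k + 1) - powerSumDefect s k‖ ≤
      ‖s * (s - 1) * (s - 2) * (s - 3)‖ * ∫ t in (k : ℝ)..(k + 1 : ℝ), t ^ (s.re - 4) := by
  have hk' : (0 : ℝ) < k := by exact_mod_cast hk
  have h0 : (0 : ℝ) ∉ Set.uIcc (k : ℝ) (k + 1) := by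
    rw [Set.uIcc_of_le (by linarith)]
    exact fun h => absurd h.1 (by linarith)
  rw [powerSumDefect_succ_sub hs hk, norm_mul]
  have h1 : ‖∫ t in (k : ℝ)..(k + 1 : ℝ),
      ((t - k : ℂ) ^ 2 * (1 - (t - k)) ^ 2) * (t : ℂ) ^ (s - 4)‖ ≤
      ∫ t in (k : ℝ)..(k + 1 : ℝ), t ^ (s.re - 4) := by
    apply intervalIntegral.norm_integral_le_of_norm_le (by linarith)
    · refine Eventually.of_forall fun t ht => ?_
      rw [norm_mul, Complex.norm_cpow_eq_rpow_re_of_pos (by linarith [ht.1])]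
      have e : ((t - k : ℂ) ^ 2 * (1 - (t - k)) ^ 2) = (((t - k) ^ 2 * (1 - (t - k)) ^ 2 : ℝ) : ℂ) := by
        push_cast; rfl
      rw [e, Complex.norm_real, Real.norm_of_nonneg (by positivity)]
      have a1 : (t - k) ^ 2 ≤ 1 := pow_le_one₀ (by linarith [ht.1]) (by linarith [ht.2])
      have a2 : (1 - (t - k)) ^ 2 ≤ 1 := pow_le_one₀ (by linarith [ht.2]) (by linarith [ht.1])
      have : 0 ≤ t ^ (s.re - 4) := Real.rpow_nonneg (by linarith [ht.1]) _
      simpa using mul_le_mul_of_nonneg_right (mul_le_one₀ a1 (by positivity) a2) this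
    · exact intervalIntegral.intervalIntegrable_rpow (Or.inr h0)
  refine mul_le_mul ?_ h1 (norm_nonneg _) (norm_nonneg _)
  rw [norm_neg, norm_div]
  exact div_le_self (norm_nonneg _) (by norm_num)

/-- The factor `s - 3` of the Euler–Maclaurin remainder turns the bound into a telescoping one,
uniformly in the sign of `s - 3`; at `s = 3` both sides vanish. -/
theorem norm_powerSumDefect_succ_sub_le_abs {s : ℝ} (hs : -1 < s) {k : ℕ} (hk : 1 ≤ k) :
    ‖powerSumDefect s (k + 1) - powerSumDefect s k‖ ≤
      |s * (s - 1) * (s - 2)| * |((k + 1 : ℕ) : ℝ) ^ (s - 3) - (k : ℝ) ^ (s - 3)| := by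
  have hk' : (0 : ℝ) < k := by exact_mod_cast hk
  have hs' : (s : ℂ) ≠ -1 := by
    intro h
    have : s = -1 := by exact_mod_cast h
    linarith
  refine (norm_powerSumDefect_succ_sub_le hs' hk).trans ?_
  have e : (s : ℂ) * (s - 1) * (s - 2) * (s - 3) = ((s * (s - 1) * (s - 2) * (s - 3) : ℝ) : ℂ) := by
    push_cast; rfl
  rw [e, Complex.norm_real, Real.norm_eq_abs, Complex.ofReal_re, abs_mul, mul_assoc]
  refine mul_le_mul_of_nonneg_left ?_ (abs_nonneg _)
  rcases eq_or_ne s 3 with rfl | h3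
  · simp
  · have h0 : (0 : ℝ) ∉ Set.uIcc (k : ℝ) (k + 1) := by
      rw [Set.uIcc_of_le (by linarith)]
      exact fun h => absurd h.1 (by linarith)
    have hne : s - 3 ≠ 0 := sub_ne_zero.2 h3
    rw [integral_rpow (Or.inr ⟨fun h => hne (by linarith), h0⟩)]
    have hn : 0 ≤ ((k + 1 : ℝ) ^ (s - 4 + 1) - (k : ℝ) ^ (s - 4 + 1)) / (s - 4 + 1) := by
      rw [← integral_rpow (Or.inr ⟨fun h => hne (by linarith), h0⟩)]
      exact intervalIntegral.integral_nonneg (by linarith)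
        fun t ht => Real.rpow_nonneg (by linarith [ht.1]) _
    rw [← abs_of_nonneg hn, ← abs_mul, show s - 4 + 1 = s - 3 by ring, mul_div_cancel₀ _ hne]
    push_cast
    exact le_rfl

/-- For exponents at least `3` the boundary term `n ^ (s - 3)` dominates any constant. -/
theorem norm_powerSumDefect_le {s : ℝ} (hs : 3 ≤ s) :
    ∃ C, ∀ n : ℕ, 1 ≤ n → ‖powerSumDefect s n‖ ≤ C * (n : ℝ) ^ (s - 3) := by
  set A := |s * (s - 1) * (s - 2)|
  have hA : 0 ≤ A := abs_nonneg _
  set B := ‖powerSumDefect s 1‖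
  have hB : 0 ≤ B := norm_nonneg _
  have key : ∀ n : ℕ, 1 ≤ n → ‖powerSumDefect s n‖ ≤ B + A * ((n : ℝ) ^ (s - 3) - 1) := by
    intro n hn
    induction n, hn using Nat.le_induction with
    | base => simp [B]
    | succ k hk ih =>
      have h := norm_powerSumDefect_succ_sub_le_abs (s := s) (by linarith) hk
      have hm : (k : ℝ) ^ (s - 3) ≤ ((k + 1 : ℕ) : ℝ) ^ (s - 3) :=
        Real.rpow_le_rpow (by positivity) (by push_cast; linarith) (by linarith)
      rw [abs_of_nonneg (sub_nonneg.2 hm)] at h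
      have := norm_le_norm_add_norm_sub' (powerSumDefect s (k + 1)) (powerSumDefect s k)
      change _ ≤ A * _ at h
      linarith
  refine ⟨A + B, fun n hn => (key n hn).trans ?_⟩
  have h1 : 1 ≤ (n : ℝ) ^ (s - 3) := Real.one_le_rpow (by exact_mod_cast hn) (by linarith)
  nlinarith

/-- Below exponent `3` the defect converges, and telescoping gives the rate. -/
theorem norm_powerSumDefect_sub_le_of_tendsto {s : ℝ} (hs : -1 < s) (hs3 : s < 3) {l : ℂ}
    (hl : Tendsto (powerSumDefect s) atTop (nhds l)) {n : ℕ} (hn : 1 ≤ n) :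
    ‖powerSumDefect s n - l‖ ≤ |s * (s - 1) * (s - 2)| * (n : ℝ) ^ (s - 3) := by
  set A := |s * (s - 1) * (s - 2)|
  have hA : 0 ≤ A := abs_nonneg _
  have key : ∀ m : ℕ, n ≤ m → ‖powerSumDefect s n - powerSumDefect s m‖ ≤
      A * ((n : ℝ) ^ (s - 3) - (m : ℝ) ^ (s - 3)) := by
    intro m hm
    induction m, hm using Nat.le_induction with
    | base => simp
    | succ k hk ih =>
      have hk1 := hn.trans hk
      have h := norm_powerSumDefect_succ_sub_le_abs hs hk1
      have hk' : (0 : ℝ) < k := by exact_mod_cast hk1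
      have hm : ((k + 1 : ℕ) : ℝ) ^ (s - 3) ≤ (k : ℝ) ^ (s - 3) :=
        Real.rpow_le_rpow_of_nonpos hk' (by push_cast; linarith) (by linarith)
      rw [abs_of_nonpos (sub_nonpos.2 hm), norm_sub_rev] at h
      have := norm_sub_le_norm_sub_add_norm_sub (powerSumDefect s n) (powerSumDefect s k)
        (powerSumDefect s (k + 1))
      change _ ≤ A * _ at h
      linarith
  refine le_of_tendsto ((tendsto_const_nhds.sub hl).norm) ?_
  filter_upwards [eventually_ge_atTop n] with m hm
  refine (key m hm).trans (mul_le_mul_of_nonneg_left ?_ hA)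
  linarith [Real.rpow_nonneg (Nat.cast_nonneg (α := ℝ) m) (s - 3)]

/-! ### Identification of the constant with a zeta value -/

theorem norm_powerSumDefect_succ_sub_le_rpow {s : ℂ} (hs : s ≠ -1) {R c : ℝ} (hR : ‖s‖ ≤ R)
    (hc : s.re ≤ c) (hc4 : c ≤ 4) {k : ℕ} (hk : 1 ≤ k) :
    ‖powerSumDefect s (k + 1) - powerSumDefect s k‖ ≤
      R * (R + 1) * (R + 2) * (R + 3) * (k : ℝ) ^ (c - 4) := by
  have hk1 : (1 : ℝ) ≤ k := by exact_mod_cast hk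
  have hR0 : 0 ≤ R := (norm_nonneg s).trans hR
  refine (norm_powerSumDefect_succ_sub_le hs hk).trans (mul_le_mul ?_ ?_ ?_ (by positivity))
  · have h : ∀ z : ℂ, ‖s - z‖ ≤ R + ‖z‖ := fun z => (norm_sub_le _ _).trans (by linarith)
    have h1 : ‖s - 1‖ ≤ R + 1 := by simpa using h 1
    have h2 : ‖s - 2‖ ≤ R + 2 := by simpa using h 2
    have h3 : ‖s - 3‖ ≤ R + 3 := by simpa using h 3
    rw [norm_mul, norm_mul, norm_mul]
    gcongr
  · have := intervalIntegral.norm_integral_le_of_norm_le_const (a := (k : ℝ)) (b := k + 1)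
      (f := fun t : ℝ => t ^ (s.re - 4)) (C := (k : ℝ) ^ (c - 4)) ?_
    · exact (Real.le_norm_self _).trans (by simpa using this)
    · intro t ht
      rw [Set.uIoc_of_le (by linarith)] at ht
      have ht0 : 1 ≤ t := hk1.trans ht.1.le
      rw [Real.norm_of_nonneg (Real.rpow_nonneg (by linarith) _)]
      exact (Real.rpow_le_rpow_of_exponent_le ht0 (by linarith)).trans
        (Real.rpow_le_rpow_of_nonpos (by linarith) ht.1.le (by linarith))
  · exact intervalIntegral.integral_nonneg (by linarith)
      fun t ht => Real.rpow_nonneg (by linarith [ht.1]) _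

/-- The limit of `powerSumDefect s n` for `re s < 3`, written as a series of increments so that its
analyticity can be read off. The index is shifted because the defect is only meaningful from
`n = 1` on. -/
noncomputable def powerSumConstant (s : ℂ) : ℂ :=
  powerSumDefect s 1 + ∑' k : ℕ, (powerSumDefect s (k + 1 + 1) - powerSumDefect s (k + 1))

theorem summable_nat_add_one_rpow {c : ℝ} (hc : c < 3) (A : ℝ) :
    Summable fun k : ℕ => A * ((k + 1 : ℕ) : ℝ) ^ (c - 4) :=
  ((summable_nat_add_iff (f := fun k : ℕ => (k : ℝ) ^ (c - 4)) 1).2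
    (Real.summable_nat_rpow.2 (by linarith))).mul_left A

theorem tendsto_powerSumDefect {s : ℂ} (hs : s ≠ -1) (hs3 : s.re < 3) :
    Tendsto (powerSumDefect s) atTop (nhds (powerSumConstant s)) := by
  have hsum : Summable fun k : ℕ => powerSumDefect s (k + 1 + 1) - powerSumDefect s (k + 1) :=
    Summable.of_norm_bounded (summable_nat_add_one_rpow hs3 _) fun k =>
      norm_powerSumDefect_succ_sub_le_rpow hs le_rfl le_rfl (by linarith) (Nat.le_add_left 1 k)
  have h := hsum.hasSum.tendsto_sum_nat.const_add (powerSumDefect s 1)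
  rw [← tendsto_add_atTop_iff_nat 1]
  refine h.congr fun n => ?_
  rw [Finset.sum_range_sub (fun k => powerSumDefect s (k + 1))]
  ring

theorem differentiableAt_powerSumDefect {s : ℂ} (hs : s ≠ -1) {n : ℕ} (hn : 1 ≤ n) :
    DifferentiableAt ℂ (fun s => powerSumDefect s n) s := by
  have hs1 : s + 1 ≠ 0 := fun h => hs (eq_neg_of_add_eq_zero_left h)
  have hpow : ∀ k : ℕ, 1 ≤ k → ∀ f : ℂ → ℂ, DifferentiableAt ℂ f s →
      DifferentiableAt ℂ (fun s => (k : ℂ) ^ f s) s := fun k hk f hf =>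
    hf.const_cpow (Or.inl (by exact_mod_cast (Nat.one_le_iff_ne_zero.1 hk)))
  unfold powerSumDefect
  refine ((DifferentiableAt.sub ?_ ?_).add ?_).sub ?_
  · exact DifferentiableAt.fun_sum fun k hk => hpow k (Finset.mem_Ico.1 hk).1 _ differentiableAt_id
  · exact (hpow n hn _ (by fun_prop)).div (by fun_prop) hs1
  · exact (hpow n hn _ differentiableAt_id).div_const _
  · exact (differentiableAt_id.mul (hpow n hn _ (by fun_prop))).div_const _

theorem differentiableOn_powerSumConstant {U : Set ℂ} (hU : IsOpen U) (hU1 : ∀ s ∈ U, s ≠ -1)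
    {R c : ℝ} (hR : ∀ s ∈ U, ‖s‖ ≤ R) (hc : ∀ s ∈ U, s.re ≤ c) (hc3 : c < 3) :
    DifferentiableOn ℂ powerSumConstant U := by
  have hd : ∀ n : ℕ, 1 ≤ n → DifferentiableOn ℂ (fun s => powerSumDefect s n) U :=
    fun n hn s hs => (differentiableAt_powerSumDefect (hU1 s hs) hn).differentiableWithinAt
  refine (hd 1 le_rfl).add ?_
  exact Complex.differentiableOn_tsum_of_summable_norm
    (summable_nat_add_one_rpow hc3 (R * (R + 1) * (R + 2) * (R + 3)))
    (fun k => (hd (k + 1 + 1) (Nat.le_add_left 1 _)).sub (hd (k + 1) (Nat.le_add_left 1 _))) hU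
    fun k s hs => norm_powerSumDefect_succ_sub_le_rpow (hU1 s hs) (hR s hs) (hc s hs)
      (by linarith) (Nat.le_add_left 1 k)

/-- In the half plane of convergence the boundary terms tend to zero and only the Dirichlet series
remains. -/
theorem powerSumConstant_eq_riemannZeta_of_re_lt {s : ℂ} (hs : s.re < -1) :
    powerSumConstant s = riemannZeta (-s) := by
  have hne : s ≠ -1 := by
    rintro rfl
    simp at hs
  have hs' : 1 < (-s).re := by
    rw [Complex.neg_re]
    linarith
  refine tendsto_nhds_unique (tendsto_powerSumDefect hne (by linarith)) ?_
  have hpow : ∀ r : ℂ, r.re < 0 → Tendsto (fun n : ℕ => (n : ℂ) ^ r) atTop (nhds 0) := by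
    intro r hr
    rw [tendsto_zero_iff_norm_tendsto_zero]
    have h := (tendsto_rpow_neg_atTop (y := -r.re) (by linarith)).comp
      tendsto_natCast_atTop_atTop
    refine h.congr' ?_
    filter_upwards [eventually_ge_atTop 1] with n hn
    have hn0 : (0 : ℝ) < n := by exact_mod_cast hn
    have := Complex.norm_cpow_eq_rpow_re_of_pos hn0 r
    simpa using this.symm
  have hzeta : Tendsto (fun n : ℕ => ∑ k ∈ Finset.Ico 1 n, (k : ℂ) ^ s) atTop
      (nhds (riemannZeta (-s))) := by
    have hsum : Summable fun n : ℕ => 1 / (n : ℂ) ^ (-s) := Complex.summable_one_div_nat_cpow.2 hs'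
    rw [zeta_eq_tsum_one_div_nat_cpow hs']
    refine hsum.hasSum.tendsto_sum_nat.congr fun n => ?_
    have hs0 : -s ≠ 0 := by
      intro h
      rw [h] at hs'
      simp at hs'
      linarith
    rcases n with _ | n
    · simp
    · rw [Finset.range_eq_Ico, Finset.sum_eq_sum_Ico_succ_bot (Nat.succ_pos n)]
      simp [Complex.zero_cpow hs0, Complex.cpow_neg]
  have h := ((hzeta.sub ((hpow (s + 1) (by simp; linarith)).div_const (s + 1))).add
    ((hpow s (by linarith)).div_const 2)).sub
    (((hpow (s - 1) (by simp; linarith)).const_mul s).div_const 12)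
  simp only [zero_div, sub_zero, add_zero, mul_zero] at h
  exact h

/-- The constant in the Euler–Maclaurin expansion of a power sum is a value of the zeta function.
The identity is continued from `re s < -1` along the upper half plane, so as to pass around the pole
of both sides at `s = -1`. -/
theorem powerSumConstant_eq_riemannZeta {s : ℝ} (hs : -1 < s) (hs3 : s < 3) :
    powerSumConstant s = riemannZeta (-s) := by
  set c : ℝ := (s + 3) / 2
  have hc3 : c < 3 := by simp only [c]; linarith
  have hc0 : 1 < c := by simp only [c]; linarith
  have hsc : s < c := by simp only [c]; linarith
  set B : Set ℂ := Metric.ball 0 9 ∩ {z | z.re < c}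
  have hBo : IsOpen B := Metric.isOpen_ball.inter (isOpen_lt Complex.continuous_re continuous_const)
  have hBc : Convex ℝ B := (convex_ball 0 9).inter (convex_halfSpace_re_lt c)
  set U₁ : Set ℂ := B ∩ {z | z.re < -1}
  set U₂ : Set ℂ := B ∩ {z | 0 < z.im}
  set U₃ : Set ℂ := B ∩ {z | -1 < z.re}
  have ho₁ : IsOpen U₁ := hBo.inter (isOpen_lt Complex.continuous_re continuous_const)
  have ho₂ : IsOpen U₂ := hBo.inter (isOpen_lt continuous_const Complex.continuous_im)
  have ho₃ : IsOpen U₃ := hBo.inter (isOpen_lt continuous_const Complex.continuous_re)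
  have hp₁ : IsPreconnected U₁ := (hBc.inter (convex_halfSpace_re_lt _)).isPreconnected
  have hp₂ : IsPreconnected U₂ := (hBc.inter (convex_halfSpace_im_gt _)).isPreconnected
  have hp₃ : IsPreconnected U₃ := (hBc.inter (convex_halfSpace_re_gt _)).isPreconnected
  have hmem : ∀ a b : ℝ, |a| ≤ 4 → |b| ≤ 4 → a < c → (⟨a, b⟩ : ℂ) ∈ B := by
    intro a b ha hb hac
    refine ⟨?_, hac⟩
    rw [mem_ball_zero_iff]
    exact (Complex.norm_le_abs_re_add_abs_im _).trans_lt (by simp only; linarith)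
  have m₁ : (⟨-2, 1⟩ : ℂ) ∈ U₁ :=
    ⟨hmem _ _ (by norm_num) (by norm_num) (by linarith), by simp⟩
  have m₁' : (⟨-2, 1⟩ : ℂ) ∈ U₂ := ⟨m₁.1, by simp⟩
  have m₂ : (⟨0, 1⟩ : ℂ) ∈ U₂ :=
    ⟨hmem _ _ (by norm_num) (by norm_num) (by linarith), by simp⟩
  have m₂' : (⟨0, 1⟩ : ℂ) ∈ U₃ := ⟨m₂.1, by simp⟩
  have hV : IsPreconnected (U₁ ∪ U₂ ∪ U₃) :=
    (hp₁.union _ m₁ m₁' hp₂).union _ (Or.inr m₂) m₂' hp₃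
  have hVo : IsOpen (U₁ ∪ U₂ ∪ U₃) := (ho₁.union ho₂).union ho₃
  have hVB : ∀ z ∈ U₁ ∪ U₂ ∪ U₃, z ∈ B := by
    rintro z ((h | h) | h) <;> exact h.1
  have hV1 : ∀ z ∈ U₁ ∪ U₂ ∪ U₃, z ≠ -1 := by
    rintro z ((h | h) | h) rfl <;> simpa using h.2
  have hf := (differentiableOn_powerSumConstant hVo hV1
    (fun z hz => (mem_ball_zero_iff.1 (hVB z hz).1).le) (fun z hz => (hVB z hz).2.le)
    hc3).analyticOnNhd hVo
  have hg : AnalyticOnNhd ℂ (fun z => riemannZeta (-z)) (U₁ ∪ U₂ ∪ U₃) := by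
    refine DifferentiableOn.analyticOnNhd (fun z hz => ?_) hVo
    have h1 : -z ≠ 1 := fun h => hV1 z hz (neg_eq_iff_eq_neg.1 h)
    exact ((differentiableAt_riemannZeta h1).comp z
      differentiableAt_id.neg).differentiableWithinAt
  refine hf.eqOn_of_preconnected_of_eventuallyEq hg hV (Or.inl (Or.inl m₁)) ?_ (Or.inr ⟨?_, ?_⟩)
  · filter_upwards [ho₁.mem_nhds m₁] with z hz
    exact powerSumConstant_eq_riemannZeta_of_re_lt hz.2
  · have := hmem s 0 (abs_le.2 ⟨by linarith, by linarith⟩) (by simp) hsc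
    exact this
  · simpa using hs

/-- The power sum expansion for every exponent `s > -1`. From `s = 3` on the zeta term is itself
within the error. -/
theorem norm_powerSumDefect_sub_riemannZeta_le {s : ℝ} (hs : -1 < s) :
    ∃ C, ∀ n : ℕ, 1 ≤ n → ‖powerSumDefect s n - riemannZeta (-s)‖ ≤ C * (n : ℝ) ^ (s - 3) := by
  rcases lt_or_ge s 3 with h3 | h3
  · refine ⟨_, fun n hn => norm_powerSumDefect_sub_le_of_tendsto hs h3 ?_ hn⟩
    rw [← powerSumConstant_eq_riemannZeta hs h3]
    refine tendsto_powerSumDefect ?_ (by simpa using h3)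
    intro h
    have : s = -1 := by exact_mod_cast h
    linarith
  · obtain ⟨C, hC⟩ := norm_powerSumDefect_le h3
    refine ⟨C + ‖riemannZeta (-s)‖, fun n hn => (norm_sub_le _ _).trans ?_⟩
    have h1 : 1 ≤ (n : ℝ) ^ (s - 3) := Real.one_le_rpow (by exact_mod_cast hn) (by linarith)
    nlinarith [hC n hn, norm_nonneg (riemannZeta (-s))]

/-- At a real exponent the defect is real. -/
theorem powerSumDefect_ofReal (s : ℝ) (n : ℕ) :
    powerSumDefect s n = ((∑ k ∈ Finset.Ico 1 n, (k : ℝ) ^ s - (n : ℝ) ^ (s + 1) / (s + 1)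
      + (n : ℝ) ^ s / 2 - s * (n : ℝ) ^ (s - 1) / 12 : ℝ) : ℂ) := by
  have h : ∀ (k : ℕ) (r : ℝ), (((k : ℝ) ^ r : ℝ) : ℂ) = (k : ℂ) ^ (r : ℂ) := fun k r => by
    rw [Complex.ofReal_cpow (Nat.cast_nonneg k), Complex.ofReal_natCast]
  unfold powerSumDefect
  push_cast [h]
  rfl

/-! ### Expansion of the trapezoidal sum -/

theorem intervalIntegrable_polynomial_div_rpow {α : ℝ} (hα : 0 < α) {x : ℝ} (hx : 0 < x)
    (y : Polynomial ℝ) :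
    IntervalIntegrable (fun t : ℝ => y.eval t / (x - t) ^ (1 - α)) volume 0 x := by
  have h := (intervalIntegral.intervalIntegrable_rpow' (a := x) (b := 0) (r := α - 1)
    (by linarith)).comp_sub_left x
  simp only [sub_self, sub_zero] at h
  refine (h.continuousOn_mul y.continuous.continuousOn).congr fun t ht => ?_
  rw [Set.uIoc_of_le hx.le] at ht
  rw [show α - 1 = -(1 - α) by ring, Real.rpow_neg (by linarith [ht.2]), div_eq_mul_inv]

/-- The difference between the two sides of the expansion of the trapezoidal sum with `n` nodes. -/
noncomputable def trapError (α x : ℝ) (y : Polynomial ℝ) (n : ℕ) : ℝ :=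
  trapSum α (fun t => y.eval t) x (x / n) n
    - (fracK α (fun t => y.eval t) x
      + ((α - 1) * x ^ (α - 2) * y.eval 0
          - x ^ (α - 1) * y.derivative.eval 0) / 12 * (x / n) ^ 2
      + realZeta (1 - α) * y.eval x * (x / n) ^ α
      - realZeta (-α) * y.derivative.eval x * (x / n) ^ (1 + α)
      + realZeta (-1 - α) * (y.derivative.derivative.eval x / 2) * (x / n) ^ (2 + α)
      - realZeta (-2 - α) * (y.derivative.derivative.derivative.eval x / 6) * (x / n) ^ (3 + α))

theorem trapError_add {α : ℝ} (hα : 0 < α) {x : ℝ} (hx : 0 < x) (y z : Polynomial ℝ) (n : ℕ) :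
    trapError α x (y + z) n = trapError α x y n + trapError α x z n := by
  have hK : fracK α (fun t => (y + z).eval t) x =
      fracK α (fun t => y.eval t) x + fracK α (fun t => z.eval t) x := by
    unfold fracK
    rw [← intervalIntegral.integral_add (intervalIntegrable_polynomial_div_rpow hα hx y)
      (intervalIntegrable_polynomial_div_rpow hα hx z)]
    simp only [Polynomial.eval_add, add_div]
  unfold trapError
  rw [hK]
  simp only [trapSum, Polynomial.eval_add, Polynomial.derivative_add, add_div,
    Finset.sum_add_distrib]
  ring

theorem fracK_const_sub_pow {α : ℝ} (hα : 0 < α) {x : ℝ} (hx : 0 < x) (c : ℝ) (j : ℕ) :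
    fracK α (fun t => c * (x - t) ^ j) x = c * (x ^ (α - 1 + j + 1) / (α - 1 + j + 1)) := by
  have hj : (0 : ℝ) ≤ j := Nat.cast_nonneg j
  unfold fracK
  rw [intervalIntegral.integral_comp_sub_left (fun u : ℝ => c * u ^ j / u ^ (1 - α)) x]
  simp only [sub_self, sub_zero]
  have h : ∫ u in (0 : ℝ)..x, c * u ^ j / u ^ (1 - α) =
      ∫ u in (0 : ℝ)..x, c * u ^ (α - 1 + j) := by
    refine intervalIntegral.integral_congr_ae (Eventually.of_forall fun u hu => ?_)
    rw [Set.uIoc_of_le hx.le] at hu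
    rw [Real.rpow_add_natCast hu.1.ne', show α - 1 = -(1 - α) by ring, Real.rpow_neg hu.1.le]
    ring
  rw [h, intervalIntegral.integral_const_mul, integral_rpow (Or.inl (by linarith)),
    Real.zero_rpow (by linarith), sub_zero]

/-- For a power of `x - t` the weighted trapezoidal sum is a pure power sum, rescaled by
`h = x / n`. -/
theorem trapSum_sub_fracK_const_sub_pow {α : ℝ} (hα : 0 < α) {x : ℝ} (hx : 0 < x) (c : ℝ)
    (j : ℕ) {n : ℕ} (hn : 1 ≤ n) :
    trapSum α (fun t => c * (x - t) ^ j) x (x / n) n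
      - (fracK α (fun t => c * (x - t) ^ j) x
        + c * (α - 1 + j) * x ^ (α - 1 + j - 1) / 12 * (x / n) ^ 2) =
    c * (x / n) ^ (α - 1 + j + 1) *
      (∑ k ∈ Finset.Ico 1 n, (k : ℝ) ^ (α - 1 + j) - (n : ℝ) ^ (α - 1 + j + 1) / (α - 1 + j + 1)
        + (n : ℝ) ^ (α - 1 + j) / 2 - (α - 1 + j) * (n : ℝ) ^ (α - 1 + j - 1) / 12) := by
  have hn0 : (0 : ℝ) < n := by exact_mod_cast hn
  have hh : 0 < x / n := by positivity
  rw [fracK_const_sub_pow hα hx]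
  unfold trapSum
  have hsum : (x / n) ^ α * ∑ k ∈ Finset.Ico 1 n,
      c * (x - (x - k * (x / n))) ^ j / (k : ℝ) ^ (1 - α) =
      c * (x / n) ^ (α - 1 + j + 1) * ∑ k ∈ Finset.Ico 1 n, (k : ℝ) ^ (α - 1 + j) := by
    rw [Finset.mul_sum, Finset.mul_sum]
    refine Finset.sum_congr rfl fun k hk => ?_
    have hk0 : (0 : ℝ) < k := by exact_mod_cast (Finset.mem_Ico.1 hk).1
    rw [show α - 1 + j + 1 = α + j by ring, Real.rpow_add_natCast hh.ne',
      Real.rpow_add_natCast hk0.ne', show α - 1 = -(1 - α) by ring, Real.rpow_neg hk0.le,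
      sub_sub_cancel, mul_pow]
    ring
  have hend : c * (x - 0) ^ j / (2 * x ^ (1 - α)) = c * x ^ (α - 1 + j) / 2 := by
    rw [Real.rpow_add_natCast hx.ne', show α - 1 = -(1 - α) by ring, Real.rpow_neg hx.le, sub_zero]
    field_simp
  rw [hsum, hend]
  set s := α - 1 + j
  have e1 : (x / n) ^ (s + 1) * (n : ℝ) ^ (s + 1) = x ^ (s + 1) := by
    rw [← Real.mul_rpow hh.le hn0.le, div_mul_cancel₀ _ hn0.ne']
  have e2 : (x / n) ^ (s + 1) * (n : ℝ) ^ s = x ^ s * (x / n) := by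
    rw [Real.rpow_add_one hh.ne', mul_right_comm, ← Real.mul_rpow hh.le hn0.le,
      div_mul_cancel₀ _ hn0.ne']
  have e3 : (x / n) ^ (s + 1) * (n : ℝ) ^ (s - 1) = x ^ (s - 1) * (x / n) ^ 2 := by
    rw [show s + 1 = s - 1 + (2 : ℕ) by push_cast; ring, Real.rpow_add_natCast hh.ne',
      mul_right_comm, ← Real.mul_rpow hh.le hn0.le, div_mul_cancel₀ _ hn0.ne']
  linear_combination (c / (s + 1)) * e1 - c / 2 * e2 + c * s / 12 * e3

/-- Only the first four powers of `x - t` have a nonzero derivative of order at most three at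
`t = x`, hence a zeta term. -/
theorem trapError_const_sub_pow {α : ℝ} (hα : 0 < α) {x : ℝ} (hx : 0 < x) (c : ℝ)
    (j : ℕ) {n : ℕ} (hn : 1 ≤ n) :
    trapError α x (Polynomial.C c * (Polynomial.C x - Polynomial.X) ^ j) n =
    c * (x / n) ^ (α - 1 + j + 1) *
      ((powerSumDefect (α - 1 + j : ℝ) n).re
        - if j < 4 then realZeta (-(α - 1 + j)) else 0) := by
  have hcore := trapSum_sub_fracK_const_sub_pow hα hx c j hn
  rw [powerSumDefect_ofReal, Complex.ofReal_re, mul_sub, ← hcore]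
  have hend : (α - 1) * x ^ (α - 2) * (c * x ^ j)
      - x ^ (α - 1) * (-(c * (j * x ^ (j - 1)))) = c * (α - 1 + j) * x ^ (α - 1 + j - 1) := by
    have e : α - 1 + j - 1 = α - 2 + j := by ring
    rw [e, Real.rpow_add_natCast hx.ne', show α - 1 = α - 2 + 1 by ring,
      Real.rpow_add_one hx.ne']
    rcases j with _ | j
    · simp; ring
    · push_cast
      ring
  unfold trapError
  simp only [Polynomial.eval_mul, Polynomial.eval_pow, Polynomial.eval_sub, Polynomial.eval_C,
    Polynomial.eval_X]
  rw [← hend]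
  clear hcore hend
  generalize trapSum α (fun t => c * (x - t) ^ j) x (x / n) n = T
  generalize fracK α (fun t => c * (x - t) ^ j) x = K
  rcases j with _ | _ | _ | _ | j
  · simp
    ring_nf
  · simp
    ring_nf
  · simp [Polynomial.derivative_pow]
    ring_nf
  · simp [Polynomial.derivative_pow]
    ring_nf
  · rw [if_neg (by omega)]
    simp [Polynomial.derivative_pow]

theorem trapError_const_sub_pow_isBigO {α : ℝ} (hα : 0 < α) {x : ℝ} (hx : 0 < x) (c : ℝ) (j : ℕ) :
    trapError α x (Polynomial.C c * (Polynomial.C x - Polynomial.X) ^ j)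
      =O[atTop] (fun n : ℕ => (x / n) ^ 4) := by
  set s : ℝ := α - 1 + j
  have hj0 : (0 : ℝ) ≤ j := Nat.cast_nonneg j
  have hs : -1 < s := by simp only [s]; linarith
  obtain ⟨C, hC⟩ : ∃ C, ∀ n : ℕ, 1 ≤ n →
      |(powerSumDefect s n).re - if j < 4 then realZeta (-s) else 0| ≤ C * (n : ℝ) ^ (s - 3) := by
    by_cases hj : j < 4
    · obtain ⟨C, hC⟩ := norm_powerSumDefect_sub_riemannZeta_le hs
      refine ⟨C, fun n hn => le_trans ?_ (hC n hn)⟩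
      rw [if_pos hj]
      have := Complex.abs_re_le_norm (powerSumDefect s n - riemannZeta (-s))
      simpa [realZeta] using this
    · have : (4 : ℝ) ≤ j := by exact_mod_cast not_lt.1 hj
      obtain ⟨C, hC⟩ := norm_powerSumDefect_le (s := s) (by simp only [s]; linarith)
      refine ⟨C, fun n hn => le_trans ?_ (hC n hn)⟩
      rw [if_neg hj, sub_zero]
      exact Complex.abs_re_le_norm _
  refine IsBigO.of_bound (|c| * C * x ^ (s - 3)) ?_
  filter_upwards [eventually_ge_atTop 1] with n hn
  have hn0 : (0 : ℝ) < n := by exact_mod_cast hn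
  have hh : 0 < x / n := by positivity
  have e : (x / n) ^ (s + 1) * (n : ℝ) ^ (s - 3) = x ^ (s - 3) * (x / n) ^ 4 := by
    rw [show s + 1 = s - 3 + (4 : ℕ) by push_cast; ring, Real.rpow_add_natCast hh.ne',
      mul_right_comm, ← Real.mul_rpow hh.le hn0.le, div_mul_cancel₀ _ hn0.ne']
  rw [trapError_const_sub_pow hα hx c j hn, norm_mul, norm_mul, Real.norm_eq_abs, Real.norm_eq_abs,
    Real.norm_eq_abs, Real.norm_eq_abs, abs_of_pos (Real.rpow_pos_of_pos hh _),
    abs_of_pos (pow_pos hh 4)]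
  calc |c| * (x / n) ^ (s + 1) * |(powerSumDefect s n).re - if j < 4 then realZeta (-s) else 0|
      ≤ |c| * (x / n) ^ (s + 1) * (C * (n : ℝ) ^ (s - 3)) := by
        gcongr
        exact hC n hn
    _ = |c| * C * x ^ (s - 3) * (x / n) ^ 4 := by linear_combination |c| * C * e

theorem trapError_isBigO {α : ℝ} (hα : 0 < α) {x : ℝ} (hx : 0 < x) (y : Polynomial ℝ) :
    trapError α x y =O[atTop] (fun n : ℕ => (x / n) ^ 4) := by
  have h : ∀ p : Polynomial ℝ, trapError α x (p.comp (Polynomial.C x - Polynomial.X))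
      =O[atTop] (fun n : ℕ => (x / n) ^ 4) := by
    intro p
    induction p using Polynomial.induction_on' with
    | add p q hp hq =>
      rw [Polynomial.add_comp]
      exact (hp.add hq).congr_left fun n => (trapError_add hα hx _ _ n).symm
    | monomial j c =>
      rw [Polynomial.monomial_comp]
      exact trapError_const_sub_pow_isBigO hα hx c j
  -- The reflection `t ↦ x - t` is an involution.
  have := h (y.comp (Polynomial.C x - Polynomial.X))
  rwa [Polynomial.comp_assoc, Polynomial.sub_comp, Polynomial.C_comp, Polynomial.X_comp,
    sub_sub_cancel, Polynomial.comp_X] at this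

theorem theorem2 (α : ℝ) (hα : 0 < α) (x : ℝ) (hx : 0 < x) (y : Polynomial ℝ) :
    IntervalIntegrable (fun t : ℝ => y.eval t / (x - t) ^ (1 - α)) volume 0 x ∧
    (fun n : ℕ =>
      let h : ℝ := x / n
      trapSum α (fun t => y.eval t) x h n
        - (fracK α (fun t => y.eval t) x
          + ((α - 1) * x ^ (α - 2) * y.eval 0
              - x ^ (α - 1) * y.derivative.eval 0) / 12 * h ^ 2
          + realZeta (1 - α) * y.eval x * h ^ α
          - realZeta (-α) * y.derivative.eval x * h ^ (1 + α)
          + realZeta (-1 - α) * (y.derivative.derivative.eval x / 2) * h ^ (2 + α)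
          - realZeta (-2 - α) * (y.derivative.derivative.derivative.eval x / 6) * h ^ (3 + α)))
      =O[atTop] (fun n : ℕ => (x / n) ^ 4) := by
  exact ⟨intervalIntegrable_polynomial_div_rpow hα hx y, trapError_isBigO hα hx y⟩
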